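/- Let $\mathbb{T}^3=(\mathbb{R}/2\pi\mathbb{Z})^3$ with Lebesgue measure of total mass $(2\pi)^3$; derivatives and analyticity of functions on the torus refer to the corresponding periodic functions. Put $$u(p,q)=\sum_{i=1}^3\bigl(3-\cos p^{(i)}-\cos q^{(i)}-\cos(p^{(i)}-q^{(i)})\bigr),\qquad p,q\in\mathbb{T}^3,$$ and, for $\alpha=1,2$, let $\varphi_\alpha:\mathbb{T}^3\to\mathbb{R}$ be a function that is not identically zero and is either of the form $\varphi_\alpha(p)=a_\alpha^{(0)}+\sum_{i=1}^3a_\alpha^{(i)}\cos p^{(i)}$ with $a_\alpha^{(0)},\dots,a_\alpha^{(3)}\in\mathbb{R}$, or of the form $\varphi_\alpha(p)=a_\alpha\sum_{i=1}^3\sin p^{(i)}$ with $a_\alpha\in\mathbb{R}$. Put $u_p^{(1)}(t)=u(t,p)$ and $u_p^{(2)}(t)=u(p,t)$. Then the following hold. 1. The function $u$ is real-analytic on $(\mathbb{T}^3)^2$ and $u(-p,-q)=u(p,q)$. Moreover $u(0,0)=0$, $u(p,q)>0$ for $(p,q)\neq(0,0)$, and the $6\times6$ Hessian matrix of $u$ at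 $(0,0)$ is positive definite, so that $u$ has a unique non-degenerate zero minimum at $(0,0)$. There are a positive definite real $3\times3$ matrix $U$ and real numbers $l\neq0$, $l_1,l_2>0$ with $$\Bigl(\tfrac{\partial^2u(0,0)}{\partial p^{(i)}\partial p^{(j)}}\Bigr)_{i,j}=l_1U,\quad \Bigl(\tfrac{\partial^2u(0,0)}{\partial p^{(i)}\partial q^{(j)}}\Bigr)_{i,j}=lU,\quad \Bigl(\tfrac{\partial^2u(0,0)}{\partial q^{(i)}\partial q^{(j)}}\Bigr)_{i,j}=l_2U.$$ 2. For each $\alpha=1,2$ the function $\varphi_\alpha$ is real-analytic on $\mathbb{T}^3$ and is either even or odd. 3. For each $\alpha=1,2$ the integral $$\Lambda_\alpha(p)=\int_{\mathbb{T}^3}\frac{\varphi_\alpha^2(t)}{u_p^{(\alpha)}(t)}\,dt$$ converges for every $p\in\mathbb{T}^3$ and $\Lambda_\alpha$ is continuous on $\mathbb{T}^3$; $\Lambda_\alpha(p)<\Lambda_\alpha(0)$ for every $p\neq0$; and if $\varphi_\alpha(0)=0$, then $\Lambda_\alpha$ has a non-degenerate maximum at $p=0$, that is, it is twice continuously differentiable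 near $0$, has a maximum at $0$, and its $3\times 3$ Hessian matrix at $0$ is negative definite. -/

import Mathlib

open MeasureTheory

noncomputable section

namespace TorusModel

instance two_pi_pos_fact : Fact (0 < 2 * Real.pi) := ⟨Real.two_pi_pos⟩

/-- The torus `(ℝ / 2πℤ)³`, with its group structure and topology, and with Lebesgue measure
of total mass `(2π)³`. -/
abbrev T3 : Type := Fin 3 → AddCircle (2 * Real.pi)

/-- The quotient map `ℝ³ → (ℝ / 2πℤ)³`. -/
def proj (x : Fin 3 → ℝ) : T3 := fun i => (x i : AddCircle (2 * Real.pi))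

/-- The cosine as a function on `ℝ / 2πℤ`. -/
def cosT : AddCircle (2 * Real.pi) → ℝ := Real.cos_periodic.lift

/-- The sine as a function on `ℝ / 2πℤ`. -/
def sinT : AddCircle (2 * Real.pi) → ℝ := Real.sin_periodic.lift

/-- The periodic function on `ℝ³` that corresponds to a function on the torus. -/
def lift (f : T3 → ℝ) : (Fin 3 → ℝ) → ℝ := fun x => f (proj x)

/-- The periodic function on `ℝ³ × ℝ³` that corresponds to a function of two torus variables. -/
def lift₂ (u : T3 → T3 → ℝ) : (Fin 3 → ℝ) × (Fin 3 → ℝ) → ℝ := fun z => u (proj z.1) (proj z.2)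

/-- The second order partial derivative `∂²F/∂v∂w` at `x`, with directions `v` and `w`. -/
def partial2 {E : Type*} [AddCommGroup E] [Module ℝ E] (F : E → ℝ) (x v w : E) : ℝ :=
  lineDeriv ℝ (fun y => lineDeriv ℝ F y w) x v

/-- The coordinate directions of `ℝ³`. -/
def dir (i : Fin 3) : Fin 3 → ℝ := Pi.single i 1

/-- The coordinate directions of `ℝ³ × ℝ³`: first the three `p`-directions, then the three
`q`-directions. -/
def dir₂ : Fin 3 ⊕ Fin 3 → (Fin 3 → ℝ) × (Fin 3 → ℝ) :=
  Sum.elim (fun i => (dir i, 0)) (fun i => (0, dir i))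

/-- The `3 × 3` matrix of second order partial derivatives at the origin. -/
def hessian (f : T3 → ℝ) : Matrix (Fin 3) (Fin 3) ℝ :=
  Matrix.of fun i j => partial2 (lift f) 0 (dir i) (dir j)

/-- The `6 × 6` matrix of second order partial derivatives at the origin. -/
def hessian₂ (u : T3 → T3 → ℝ) : Matrix (Fin 3 ⊕ Fin 3) (Fin 3 ⊕ Fin 3) ℝ :=
  Matrix.of fun a b => partial2 (lift₂ u) 0 (dir₂ a) (dir₂ b)

/-- The hypothesis on `u`. It is real-analytic, even in `(p, q)`, its minimum is `0`, attained only
at the origin and non-degenerate (the full Hessian is positive definite there), and the blocks of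
second derivatives `∂²u/∂p∂p`, `∂²u/∂p∂q`, `∂²u/∂q∂q` at the origin are `l₁ U`, `l U`, `l₂ U`. -/
structure HypU (u : T3 → T3 → ℝ) : Prop where
  analytic : AnalyticOnNhd ℝ (lift₂ u) Set.univ
  even : ∀ p q, u (-p) (-q) = u p q
  zero : u 0 0 = 0
  pos : ∀ p q, (p, q) ≠ (0, 0) → 0 < u p q
  nondegenerate : (hessian₂ u).PosDef
  blocks : ∃ (U : Matrix (Fin 3) (Fin 3) ℝ) (l l₁ l₂ : ℝ),
    U.PosDef ∧ 0 < l₁ ∧ 0 < l₂ ∧ l ≠ 0 ∧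
    (hessian₂ u).toBlocks₁₁ = l₁ • U ∧
    (hessian₂ u).toBlocks₁₂ = l • U ∧
    (hessian₂ u).toBlocks₂₂ = l₂ • U

/-- The hypothesis on one of the functions `φ_α`. -/
structure HypPhi (φ : T3 → ℝ) : Prop where
  analytic : AnalyticOnNhd ℝ (lift φ) Set.univ
  even_or_odd : Function.Even φ ∨ Function.Odd φ

/-- The functions `u_p^{(1)}(t) = u(t, p)` (here `α = 0`) and `u_p^{(2)}(t) = u(p, t)`
(here `α = 1`). -/
def fiber (u : T3 → T3 → ℝ) (α : Fin 2) (p t : T3) : ℝ :=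
  if α = 0 then u t p else u p t

/-- The integrand `φ²(t) / u_p^{(α)}(t)` of `Λ_α(p)`. -/
def integrand (u : T3 → T3 → ℝ) (α : Fin 2) (φ : T3 → ℝ) (p t : T3) : ℝ :=
  φ t ^ 2 / fiber u α p t

/-- `Λ_α(p) = ∫ φ²(t) / u_p^{(α)}(t) dt`. -/
def Lam (u : T3 → T3 → ℝ) (α : Fin 2) (φ : T3 → ℝ) (p : T3) : ℝ :=
  ∫ t, integrand u α φ p t

/-- `f` has a non-degenerate maximum at the origin: it is twice continuously differentiable there,
has a local maximum, and its Hessian is negative definite. -/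
structure HasNondegMaxAtZero (f : T3 → ℝ) : Prop where
  contDiffAt : ContDiffAt ℝ 2 (lift f) 0
  isLocalMax : IsLocalMax f 0
  negDef : (-hessian f).PosDef

/-- The hypothesis on `Λ_α`: the integrals that define it converge and it is continuous; it has a
strict global maximum at the origin; and this maximum is non-degenerate if `φ_α(0) = 0`. -/
structure HypLam (u : T3 → T3 → ℝ) (α : Fin 2) (φ : T3 → ℝ) : Prop where
  integrable : ∀ p, Integrable (integrand u α φ p)
  continuous : Continuous (Lam u α φ)
  lt_zero : ∀ p, p ≠ 0 → Lam u α φ p < Lam u α φ 0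
  nondegenerate : φ 0 = 0 → HasNondegMaxAtZero (Lam u α φ)

/-- `u(p, q) = ∑ᵢ (3 - cos pᵢ - cos qᵢ - cos (pᵢ - qᵢ))`. -/
def uEx (p q : T3) : ℝ :=
  ∑ i, (3 - cosT (p i) - cosT (q i) - cosT (p i - q i))

end TorusModel

end

noncomputable section

namespace TorusModel

/-! Everything rests on the splitting $u(p,q)=\varepsilon(p)+\varepsilon(q)+\varepsilon(p-q)$ with
$\varepsilon=$ `disp`, which gives $u(p,t)\ge\varepsilon(t)$ uniformly in $p$. Since $1/\varepsilon$
is integrable in dimension three (`integrable_inv_disp`), dominated convergence yields the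
finiteness and continuity of $\Lambda_\alpha$. As $u$ is symmetric, the index $\alpha$ plays no
role.

For the strict maximum, $\varphi_\alpha^2$ is even, so $1/u(p,t)$ may be averaged with $1/u(p,-t)$.
Cauchy–Schwarz (`four_mul_disp_mul_excess_le`) shows that this average never exceeds $1/u(0,t)$.
Equality on a set of full measure would make a product of nonzero analytic functions vanish
identically.

If $\varphi_\alpha(0)=0$, the special form of $\varphi_\alpha$ gives $\varphi_\alpha^2\le
C\varepsilon$. The first two $p$-derivatives of the integrand are then bounded by multiples of
$1/\varepsilon$, so $\Lambda_\alpha$ is $C^2$. Minus its Hessian form at $0$ is the integral of a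
nonnegative weight times a Cauchy–Schwarz defect, positive again by analyticity
(`posDef_neg_hessian_lam`). -/

/-! ### Trigonometry on the circle and the dispersion. -/

@[simp] lemma cosT_coe (x : ℝ) : cosT (x : AddCircle (2 * Real.pi)) = Real.cos x :=
  Function.Periodic.lift_coe _ _

@[simp] lemma sinT_coe (x : ℝ) : sinT (x : AddCircle (2 * Real.pi)) = Real.sin x :=
  Function.Periodic.lift_coe _ _

lemma continuous_cosT : Continuous cosT :=
  continuous_coinduced_dom.mpr Real.continuous_cos

lemma continuous_sinT : Continuous sinT :=
  continuous_coinduced_dom.mpr Real.continuous_sin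

lemma cosT_neg (x : AddCircle (2 * Real.pi)) : cosT (-x) = cosT x := by
  induction x using QuotientAddGroup.induction_on with
  | H x => rw [← AddCircle.coe_neg, cosT_coe, cosT_coe, Real.cos_neg]

lemma sinT_neg (x : AddCircle (2 * Real.pi)) : sinT (-x) = -sinT x := by
  induction x using QuotientAddGroup.induction_on with
  | H x => rw [← AddCircle.coe_neg, sinT_coe, sinT_coe, Real.sin_neg]

lemma cosT_sub (x y : AddCircle (2 * Real.pi)) :
    cosT (x - y) = cosT x * cosT y + sinT x * sinT y := by
  induction x using QuotientAddGroup.induction_on with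
  | H x =>
    induction y using QuotientAddGroup.induction_on with
    | H y => rw [← AddCircle.coe_sub]; simp only [cosT_coe, sinT_coe, Real.cos_sub]

lemma sinT_sq (x : AddCircle (2 * Real.pi)) : sinT x ^ 2 = (1 - cosT x) * (1 + cosT x) := by
  induction x using QuotientAddGroup.induction_on with
  | H x => simp only [cosT_coe, sinT_coe]; rw [Real.sin_sq]; ring

lemma cosT_le_one (x : AddCircle (2 * Real.pi)) : cosT x ≤ 1 := by
  induction x using QuotientAddGroup.induction_on with
  | H x => simpa using Real.cos_le_one x

lemma neg_one_le_cosT (x : AddCircle (2 * Real.pi)) : -1 ≤ cosT x := by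
  induction x using QuotientAddGroup.induction_on with
  | H x => simpa using Real.neg_one_le_cos x

@[simp] lemma cosT_zero : cosT 0 = 1 := by simpa using cosT_coe 0

@[simp] lemma sinT_zero : sinT 0 = 0 := by simpa using sinT_coe 0

lemma cosT_eq_one_iff (x : AddCircle (2 * Real.pi)) : cosT x = 1 ↔ x = 0 := by
  induction x using QuotientAddGroup.induction_on with
  | H x =>
    rw [cosT_coe, Real.cos_eq_one_iff, AddCircle.coe_eq_zero_iff]
    simp [zsmul_eq_mul]

/-- The dispersion `∑ᵢ (1 - cos tᵢ)`. -/
def disp (t : T3) : ℝ := ∑ i, (1 - cosT (t i))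

lemma continuous_disp : Continuous disp := by
  have := continuous_cosT
  unfold disp; fun_prop

lemma disp_nonneg (t : T3) : 0 ≤ disp t :=
  Finset.sum_nonneg fun _ _ => sub_nonneg.2 (cosT_le_one _)

lemma disp_eq_zero_iff (t : T3) : disp t = 0 ↔ t = 0 := by
  rw [disp, Finset.sum_eq_zero_iff_of_nonneg fun _ _ => sub_nonneg.2 (cosT_le_one _), funext_iff]
  simp only [Finset.mem_univ, true_implies, sub_eq_zero, eq_comm (a := (1 : ℝ)), cosT_eq_one_iff,
    Pi.zero_apply]

lemma disp_pos {t : T3} (ht : t ≠ 0) : 0 < disp t :=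
  lt_of_le_of_ne (disp_nonneg t) fun h => ht ((disp_eq_zero_iff t).1 h.symm)

lemma uEx_eq_disp (p q : T3) : uEx p q = disp p + disp q + disp (p - q) := by
  simp only [uEx, disp, ← Finset.sum_add_distrib, Pi.sub_apply]
  exact Finset.sum_congr rfl fun i _ => by ring

lemma disp_neg (t : T3) : disp (-t) = disp t := by simp [disp, cosT_neg]

lemma uEx_comm (p q : T3) : uEx p q = uEx q p := by
  rw [uEx_eq_disp, uEx_eq_disp, ← disp_neg (p - q), neg_sub]; ring

lemma fiber_uEx (α : Fin 2) (p t : T3) : fiber uEx α p t = uEx p t := by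
  unfold fiber; split_ifs
  · exact uEx_comm _ _
  · rfl

/-- The bound is uniform in `p`, so `1 / disp` dominates all the integrands at once. -/
lemma disp_le_uEx (p t : T3) : disp t ≤ uEx p t := by
  rw [uEx_eq_disp]; linarith [disp_nonneg p, disp_nonneg (p - t)]

lemma uEx_zero_left (t : T3) : uEx 0 t = 2 * disp t := by
  rw [uEx_eq_disp, zero_sub, disp_neg, (disp_eq_zero_iff 0).2 rfl]; ring

lemma uEx_nonneg (p t : T3) : 0 ≤ uEx p t := (disp_nonneg t).trans (disp_le_uEx p t)

lemma uEx_pos_of_right {t : T3} (p : T3) (ht : t ≠ 0) : 0 < uEx p t :=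
  (disp_pos ht).trans_le (disp_le_uEx p t)

lemma continuous_uEx : Continuous fun z : T3 × T3 => uEx z.1 z.2 := by
  have := continuous_disp
  simp only [uEx_eq_disp]; fun_prop

/-! ### Second derivatives of `u` at the origin, and its hypotheses. -/

lemma partial2_eq {E : Type*} [NormedAddCommGroup E] [NormedSpace ℝ E] {F : E → ℝ}
    {F' : E → E →L[ℝ] ℝ} {x w : E} {G : E →L[ℝ] ℝ} (hF : ∀ y, HasFDerivAt F (F' y) y)
    (hG : HasFDerivAt (fun y => F' y w) G x) (v : E) : partial2 F x v w = G v := by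
  have h : (fun y => lineDeriv ℝ F y w) = fun y => F' y w :=
    funext fun y => ((hF y).hasLineDerivAt w).lineDeriv
  rw [partial2, h, (hG.hasLineDerivAt v).lineDeriv]

/-- The `i`-th coordinate functional. -/
abbrev coord (i : Fin 3) : (Fin 3 → ℝ) →L[ℝ] ℝ := ContinuousLinearMap.proj i

lemma lift₂_uEx : lift₂ uEx = fun z => ∑ i : Fin 3,
    (3 - Real.cos (z.1 i) - Real.cos (z.2 i) - Real.cos (z.1 i - z.2 i)) := by
  funext z
  simp only [lift₂, uEx, proj, ← AddCircle.coe_sub, cosT_coe]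

lemma partial2_lift₂_uEx (v w : (Fin 3 → ℝ) × (Fin 3 → ℝ)) :
    partial2 (lift₂ uEx) 0 v w =
      ∑ i, (v.1 i * w.1 i + v.2 i * w.2 i + (v.1 i - v.2 i) * (w.1 i - w.2 i)) := by
  let P (i : Fin 3) : (Fin 3 → ℝ) × (Fin 3 → ℝ) →L[ℝ] ℝ :=
    (coord i).comp (ContinuousLinearMap.fst ℝ _ _)
  let Q (i : Fin 3) : (Fin 3 → ℝ) × (Fin 3 → ℝ) →L[ℝ] ℝ :=
    (coord i).comp (ContinuousLinearMap.snd ℝ _ _)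
  have hF : ∀ y, HasFDerivAt (lift₂ uEx) (∑ i, (Real.sin (P i y) • P i + Real.sin (Q i y) • Q i
      + Real.sin ((P i - Q i) y) • (P i - Q i))) y := by
    intro y
    rw [lift₂_uEx]
    refine HasFDerivAt.fun_sum fun i _ => ?_
    have h := ((((P i).hasFDerivAt (x := y)).cos.const_sub 3).sub
      ((Q i).hasFDerivAt (x := y)).cos).sub ((P i - Q i).hasFDerivAt (x := y)).cos
    refine h.congr_fderiv ?_
    module
  have hG : HasFDerivAt (fun y => (∑ i, (Real.sin (P i y) • P i + Real.sin (Q i y) • Q i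
      + Real.sin ((P i - Q i) y) • (P i - Q i))) w)
      (∑ i, (P i w • P i + Q i w • Q i + (P i - Q i) w • (P i - Q i))) 0 := by
    have hs : (fun y => (∑ i, (Real.sin (P i y) • P i + Real.sin (Q i y) • Q i
        + Real.sin ((P i - Q i) y) • (P i - Q i))) w) = fun y => ∑ i, (Real.sin (P i y) * P i w
        + Real.sin (Q i y) * Q i w + Real.sin ((P i - Q i) y) * (P i - Q i) w) := by
      funext y
      simp [sum_apply]
    rw [hs]
    refine HasFDerivAt.fun_sum fun i _ => ?_
    have h (A : (Fin 3 → ℝ) × (Fin 3 → ℝ) →L[ℝ] ℝ) :=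
      ((A.hasFDerivAt (x := 0)).sin).mul_const (A w)
    refine (((h (P i)).add (h (Q i))).add (h (P i - Q i))).congr_fderiv ?_
    simp
  rw [partial2_eq hF hG]
  simp only [sum_apply, add_apply,
      smul_apply, smul_eq_mul, sub_apply]
  refine Finset.sum_congr rfl fun i _ => ?_
  simp [P, Q]
  ring

lemma hessian₂_uEx :
    hessian₂ uEx = Matrix.fromBlocks ((2 : ℝ) • 1) ((-1 : ℝ) • 1) ((-1 : ℝ) • 1) ((2 : ℝ) • 1) := by
  ext a b
  rcases a with a | a <;> rcases b with b | b <;>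
    simp only [hessian₂, partial2_lift₂_uEx, dir₂, dir, Matrix.of_apply, Sum.elim_inl,
      Sum.elim_inr, Pi.zero_apply, Matrix.fromBlocks_apply₁₁, Matrix.fromBlocks_apply₁₂,
      Matrix.fromBlocks_apply₂₁, Matrix.fromBlocks_apply₂₂, Matrix.smul_apply, Matrix.one_apply,
      Pi.single_apply] <;>
    by_cases h : a = b <;>
    simp [h, eq_comm (a := b), mul_ite, Finset.sum_add_distrib] <;> norm_num

lemma hypU_uEx : HypU uEx where
  analytic := by
    rw [lift₂_uEx]
    intro z _
    refine Finset.analyticAt_fun_sum _ fun i _ => ?_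
    have h₁ : AnalyticAt ℝ (fun z : (Fin 3 → ℝ) × (Fin 3 → ℝ) => z.1 i) z :=
      ((coord i).comp (ContinuousLinearMap.fst ℝ _ _)).analyticAt z
    have h₂ : AnalyticAt ℝ (fun z : (Fin 3 → ℝ) × (Fin 3 → ℝ) => z.2 i) z :=
      ((coord i).comp (ContinuousLinearMap.snd ℝ _ _)).analyticAt z
    exact ((analyticAt_const.sub (Real.analyticAt_cos.fun_comp h₁)).sub
      (Real.analyticAt_cos.fun_comp h₂)).sub (Real.analyticAt_cos.fun_comp (h₁.sub h₂))
  even p q := by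
    rw [uEx_eq_disp, uEx_eq_disp, disp_neg, disp_neg, ← disp_neg (p - q), neg_sub_neg, neg_sub]
  zero := by rw [uEx_zero_left, (disp_eq_zero_iff 0).2 rfl, mul_zero]
  pos p q h := by
    by_cases hq : q = 0
    · rw [uEx_comm]; exact uEx_pos_of_right _ fun hp => h (by rw [hp, hq])
    · exact uEx_pos_of_right _ hq
  nondegenerate := by
    rw [hessian₂_uEx]
    refine Matrix.PosDef.of_dotProduct_mulVec_pos ?_ fun x hx => ?_
    · rw [Matrix.IsHermitian, Matrix.fromBlocks_conjTranspose]; simp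
    -- Writing the form as a sum of squares makes definiteness visible.
    · have h : star x ⬝ᵥ (Matrix.fromBlocks ((2 : ℝ) • (1 : Matrix (Fin 3) (Fin 3) ℝ))
          ((-1 : ℝ) • 1) ((-1 : ℝ) • 1) ((2 : ℝ) • 1)).mulVec x =
          ∑ i, (x (.inl i) ^ 2 + x (.inr i) ^ 2 + (x (.inl i) - x (.inr i)) ^ 2) := by
        simp [Matrix.fromBlocks_mulVec, dotProduct, Fin.sum_univ_three, Matrix.smul_mulVec,
          Matrix.neg_mulVec]
        ring
      rw [h]
      refine lt_of_le_of_ne (Finset.sum_nonneg fun _ _ => by positivity) fun h0 => hx ?_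
      have h1 := (Finset.sum_eq_zero_iff_of_nonneg fun _ _ => by positivity).1 h0.symm
      ext (i | i) <;> have := h1 i (Finset.mem_univ i) <;> simp only [Pi.zero_apply] <;>
        nlinarith [sq_nonneg (x (.inl i)), sq_nonneg (x (.inr i)),
          sq_nonneg (x (.inl i) - x (.inr i))]
  blocks := by
    refine ⟨1, -1, 2, 2, Matrix.PosDef.one, two_pos, two_pos, by norm_num, ?_⟩
    rw [hessian₂_uEx]
    simp only [Matrix.toBlocks_fromBlocks₁₁, Matrix.toBlocks_fromBlocks₁₂,
      Matrix.toBlocks_fromBlocks₂₂, and_self]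

/-! ### Integrability of `1 / disp`. -/

instance nullSingletonClass_addCircle :
    NullSingletonClass (volume : Measure (AddCircle (2 * Real.pi))) where
  measure_singleton x := by
    rw [← Metric.closedBall_zero, AddCircle.volume_closedBall]
    simp [Real.two_pi_pos.le]

instance isNegInvariant_volume_torus : (volume : Measure T3).IsNegInvariant :=
  Measure.pi.isNegInvariant _

lemma ae_coord_ne_zero : ∀ᵐ t : T3, ∀ i, t i ≠ 0 :=
  ae_all_iff.2 fun i => Measure.ae_eval_ne (μ := fun _ => volume) i 0

lemma ae_ne_zero : ∀ᵐ t : T3, t ≠ 0 := by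
  filter_upwards [ae_coord_ne_zero] with t ht h
  exact ht 0 (by rw [h]; rfl)

/-- The singularity at $0$ is of order $|\theta|^{-2/3}$, hence integrable. The exponent $1/3$ is
the weight of each coordinate in the geometric mean of three factors. -/
lemma integrable_one_sub_cosT_rpow :
    Integrable fun θ : AddCircle (2 * Real.pi) => (1 - cosT θ) ^ (-(1 / 3) : ℝ) := by
  have hm : Measurable fun θ : AddCircle (2 * Real.pi) => (1 - cosT θ) ^ (-(1 / 3) : ℝ) :=
    (measurable_const.sub continuous_cosT.measurable).pow_const _
  rw [← (AddCircle.measurePreserving_mk (2 * Real.pi) (-Real.pi)).map_eq,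
    integrable_map_measure hm.aestronglyMeasurable AddCircle.measurable_mk'.aemeasurable]
  have hr : IntervalIntegrable (fun x : ℝ => |x| ^ (-(2 / 3) : ℝ)) volume (-Real.pi) Real.pi := by
    have h₁ : IntervalIntegrable (fun x : ℝ => |x| ^ (-(2 / 3) : ℝ)) volume 0 Real.pi := by
      refine (intervalIntegral.intervalIntegrable_rpow' (r := -(2 / 3)) (by norm_num)).congr ?_
      intro x hx
      rw [Set.uIoc_of_le Real.pi_pos.le] at hx
      simp only [abs_of_pos hx.1]
    refine IntervalIntegrable.trans (b := 0) ?_ h₁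
    rw [IntervalIntegrable.iff_comp_neg]
    simpa using h₁.symm
  have hc : -Real.pi + 2 * Real.pi = Real.pi := by ring
  rw [hc]
  rw [intervalIntegrable_iff_integrableOn_Ioc_of_le (by linarith [Real.pi_pos])] at hr
  refine (hr.const_mul ((2 / Real.pi ^ 2) ^ (-(1 / 3) : ℝ))).mono'
    (hm.comp AddCircle.measurable_mk').aestronglyMeasurable ?_
  filter_upwards [ae_restrict_mem measurableSet_Ioc, ae_restrict_of_ae (Measure.ae_ne volume 0)]
    with x hx hx0
  -- The bound $1-\cos x\ge 2x^2/\pi^2$ needs $|x|\le\pi$, which is why the circle is cut at $-\pi$.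
  have hcos := Real.cos_le_one_sub_mul_cos_sq (abs_le.2 ⟨hx.1.le, hx.2⟩)
  have hpos : 0 < 2 / Real.pi ^ 2 * x ^ 2 := by
    have := Real.pi_pos
    positivity
  have hx2 : (x ^ 2) ^ (-(1 / 3) : ℝ) = |x| ^ (-(2 / 3) : ℝ) := by
    rw [← sq_abs, ← Real.rpow_natCast, ← Real.rpow_mul (abs_nonneg x)]
    norm_num
  simp only [Function.comp, cosT_coe]
  rw [Real.norm_of_nonneg (Real.rpow_nonneg (by linarith) _), ← hx2,
    ← Real.mul_rpow (by positivity) (sq_nonneg x)]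
  exact Real.rpow_le_rpow_of_nonpos hpos (by linarith) (by norm_num)

/-- By AM–GM, $\varepsilon(t)\ge\prod_i(1-\cos t_i)^{1/3}$, so $1/\varepsilon$ is dominated by a
product of integrable functions of one variable. -/
lemma integrable_inv_disp : Integrable fun t : T3 => (disp t)⁻¹ := by
  have h := Integrable.fintype_prod (ι := Fin 3) (𝕜 := ℝ) (μ := fun _ => volume)
    fun _ => integrable_one_sub_cosT_rpow
  refine h.mono' continuous_disp.measurable.inv.aestronglyMeasurable ?_
  filter_upwards [ae_coord_ne_zero] with t ht
  have hp : ∀ i, 0 < 1 - cosT (t i) := fun i =>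
    lt_of_le_of_ne (sub_nonneg.2 (cosT_le_one _)) fun h =>
      ht i ((cosT_eq_one_iff _).1 (sub_eq_zero.1 h.symm).symm)
  have hd : 0 < disp t := disp_pos fun h => ht 0 (by rw [h]; rfl)
  have hg := Real.geom_mean_le_arith_mean3_weighted (w₁ := 1 / 3) (w₂ := 1 / 3) (w₃ := 1 / 3)
    (by norm_num) (by norm_num) (by norm_num) (hp 0).le (hp 1).le (hp 2).le (by norm_num)
  rw [Real.norm_of_nonneg (inv_nonneg.2 hd.le), Fin.prod_univ_three, Real.rpow_neg (hp 0).le,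
    Real.rpow_neg (hp 1).le, Real.rpow_neg (hp 2).le, ← mul_inv, ← mul_inv]
  refine inv_anti₀ ?_ (hg.trans ?_)
  · have := fun i => Real.rpow_pos_of_pos (hp i) (1 / 3)
    exact mul_pos (mul_pos (this 0) (this 1)) (this 2)
  · rw [disp, Fin.sum_univ_three]
    linarith [hp 0, hp 1, hp 2]

/-! ### Analytic functions on the torus and positivity of integrals. -/

/-- A function on the torus that lifts to a real-analytic function. -/
def IsAnalytic (f : T3 → ℝ) : Prop := AnalyticOnNhd ℝ (lift f) Set.univ

lemma continuous_proj : Continuous proj :=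
  continuous_pi fun i => (AddCircle.continuous_mk' _).comp (continuous_apply i)

lemma surjective_proj : Function.Surjective proj := fun t => by
  choose x hx using fun i => QuotientAddGroup.mk_surjective (t i)
  exact ⟨x, funext hx⟩

lemma isAnalytic_const (c : ℝ) : IsAnalytic fun _ => c := fun _ _ => analyticAt_const

lemma isAnalytic_cosT (i : Fin 3) : IsAnalytic fun t => cosT (t i) := by
  have h : lift (fun t => cosT (t i)) = fun x => Real.cos (coord i x) :=
    funext fun x => cosT_coe _
  intro x _
  rw [h]
  exact Real.analyticAt_cos.fun_comp ((coord i).analyticAt x)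

lemma isAnalytic_sinT (i : Fin 3) : IsAnalytic fun t => sinT (t i) := by
  have h : lift (fun t => sinT (t i)) = fun x => Real.sin (coord i x) :=
    funext fun x => sinT_coe _
  intro x _
  rw [h]
  exact Real.analyticAt_sin.fun_comp ((coord i).analyticAt x)

lemma IsAnalytic.add {f g : T3 → ℝ} (hf : IsAnalytic f) (hg : IsAnalytic g) :
    IsAnalytic fun t => f t + g t := fun x hx => (hf x hx).add (hg x hx)

lemma IsAnalytic.sub {f g : T3 → ℝ} (hf : IsAnalytic f) (hg : IsAnalytic g) :
    IsAnalytic fun t => f t - g t := fun x hx => (hf x hx).sub (hg x hx)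

lemma IsAnalytic.mul {f g : T3 → ℝ} (hf : IsAnalytic f) (hg : IsAnalytic g) :
    IsAnalytic fun t => f t * g t := fun x hx => (hf x hx).mul (hg x hx)

lemma IsAnalytic.sum {f : Fin 3 → T3 → ℝ} (hf : ∀ i, IsAnalytic (f i)) :
    IsAnalytic fun t => ∑ i, f i t :=
  fun x hx => Finset.analyticAt_fun_sum _ fun i _ => hf i x hx

lemma IsAnalytic.continuous {f : T3 → ℝ} (hf : IsAnalytic f) : Continuous f := by
  have hq : IsOpenQuotientMap proj :=
    IsOpenQuotientMap.piMap fun _ => QuotientAddGroup.isOpenQuotientMap_mk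
  exact hq.isQuotientMap.continuous_iff.2 (continuousOn_univ.1 hf.continuousOn)

lemma isAnalytic_disp : IsAnalytic disp :=
  IsAnalytic.sum fun i => (isAnalytic_const 1).sub (isAnalytic_cosT i)

lemma disp_ne_zero : disp ≠ 0 := fun h => by
  have h1 := congr_fun h fun _ => ((Real.pi : ℝ) : AddCircle (2 * Real.pi))
  simp [disp] at h1

/-- The product of two nonzero analytic functions is nonzero. -/
lemma IsAnalytic.mul_ne_zero {f g : T3 → ℝ} (hf : IsAnalytic f) (hg : IsAnalytic g)
    (hf0 : f ≠ 0) (hg0 : g ≠ 0) : (fun t => f t * g t) ≠ 0 := by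
  intro h
  obtain ⟨t, ht⟩ := Function.ne_iff.1 hf0
  obtain ⟨x, rfl⟩ := surjective_proj t
  -- Near a point where `f` does not vanish, `g` must vanish; the identity theorem then kills `g`
  -- everywhere.
  have hev : lift g =ᶠ[nhds x] 0 := by
    have hc : ContinuousAt (lift f) x := (hf x trivial).continuousAt
    filter_upwards [hc.eventually_ne ht] with y hy
    exact (mul_eq_zero.1 (congr_fun h (proj y))).resolve_left hy
  have heq := hg.eq_of_eventuallyEq (fun _ _ => analyticAt_const) hev
  refine hg0 (funext fun s => ?_)
  obtain ⟨y, rfl⟩ := surjective_proj s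
  exact congr_fun heq y

/-- An integrable nonnegative function that is positive off the zeros of a nonzero continuous
function has positive integral. -/
lemma integral_pos_of_ne_zero {F f : T3 → ℝ} (hF : Integrable F) (hF0 : ∀ᵐ t, 0 ≤ F t)
    (hf : Continuous f) (hf0 : f ≠ 0) (h : ∀ t, f t ≠ 0 → F t ≠ 0) : 0 < ∫ t, F t := by
  rw [integral_pos_iff_support_of_nonneg_ae hF0 hF]
  obtain ⟨t, ht⟩ := Function.ne_iff.1 hf0
  exact ((isOpen_ne_fun hf continuous_const).measure_pos volume ⟨t, ht⟩).trans_le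
    (measure_mono h)

/-! ### Convergence and continuity of $\Lambda_\alpha$. -/

lemma lam_uEx (α : Fin 2) (φ : T3 → ℝ) (p : T3) :
    Lam uEx α φ p = ∫ t, φ t ^ 2 / uEx p t := by
  simp only [Lam, integrand, fiber_uEx]

lemma continuous_uEx_right (p : T3) : Continuous (uEx p) :=
  continuous_uEx.comp (by fun_prop : Continuous fun t : T3 => (p, t))

lemma continuous_uEx_left (t : T3) : Continuous fun p => uEx p t :=
  continuous_uEx.comp (by fun_prop : Continuous fun p : T3 => (p, t))

lemma exists_sq_le {φ : T3 → ℝ} (hφ : Continuous φ) : ∃ M, ∀ t, φ t ^ 2 ≤ M := by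
  obtain ⟨M, hM⟩ := (isCompact_range (hφ.pow 2)).bddAbove
  exact ⟨M, fun t => hM ⟨t, rfl⟩⟩

lemma measurable_sq_div_uEx {φ : T3 → ℝ} (hφ : Continuous φ) (p : T3) :
    Measurable fun t => φ t ^ 2 / uEx p t :=
  (hφ.pow 2).measurable.div (continuous_uEx_right p).measurable

lemma sq_div_uEx_le {φ : T3 → ℝ} {M : ℝ} (hM : ∀ t, φ t ^ 2 ≤ M) (p : T3) {t : T3} (ht : t ≠ 0) :
    ‖φ t ^ 2 / uEx p t‖ ≤ M * (disp t)⁻¹ := by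
  rw [Real.norm_of_nonneg (div_nonneg (sq_nonneg _) (uEx_nonneg _ _)), ← div_eq_mul_inv]
  exact div_le_div₀ ((sq_nonneg _).trans (hM t)) (hM t) (disp_pos ht) (disp_le_uEx p t)

lemma integrable_sq_div_uEx {φ : T3 → ℝ} (hφ : Continuous φ) (p : T3) :
    Integrable fun t => φ t ^ 2 / uEx p t := by
  obtain ⟨M, hM⟩ := exists_sq_le hφ
  refine (integrable_inv_disp.const_mul M).mono'
    (measurable_sq_div_uEx hφ p).aestronglyMeasurable ?_
  filter_upwards [ae_ne_zero] with t ht using sq_div_uEx_le hM p ht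

lemma continuous_integral_sq_div_uEx {φ : T3 → ℝ} (hφ : Continuous φ) :
    Continuous fun p => ∫ t, φ t ^ 2 / uEx p t := by
  obtain ⟨M, hM⟩ := exists_sq_le hφ
  refine continuous_of_dominated (fun p => (measurable_sq_div_uEx hφ p).aestronglyMeasurable)
    (fun p => ?_) (integrable_inv_disp.const_mul M) ?_
  · filter_upwards [ae_ne_zero] with t ht using sq_div_uEx_le hM p ht
  · filter_upwards [ae_ne_zero] with t ht
    exact continuous_const.div (continuous_uEx_left t) fun p => (uEx_pos_of_right p ht).ne'

/-! ### The strict global maximum at the origin. -/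

/-- The excess `∑ᵢ (1 - cos pᵢ) (1 + cos tᵢ)` of the mean of `u(p, t)` and `u(p, -t)` over
`u(0, t)`. -/
def excess (p t : T3) : ℝ := ∑ i, (1 - cosT (p i)) * (1 + cosT (t i))

lemma excess_nonneg (p t : T3) : 0 ≤ excess p t :=
  Finset.sum_nonneg fun i _ => mul_nonneg (sub_nonneg.2 (cosT_le_one _))
    (by linarith [neg_one_le_cosT (t i)])

/-- With $S=R+2\varepsilon(p)$ and $E$ the excess, $u(p,\pm t)=S\mp F$ and $u(0,t)=S-E$. The right
side is therefore $2(SE-F^2)$, and $F^2\le ER$ leaves at least $4\varepsilon(p)E$. This is the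
numerator of $2/u(0,t)-1/u(p,t)-1/u(p,-t)$. -/
lemma four_mul_disp_mul_excess_le (p t : T3) :
    4 * disp p * excess p t ≤
      2 * (uEx p t * uEx p (-t)) - (uEx p t + uEx p (-t)) * uEx 0 t := by
  set F := ∑ i, sinT (p i) * sinT (t i) with hF
  set R := ∑ i, (1 + cosT (p i)) * (1 - cosT (t i)) with hR
  have hCS : F ^ 2 ≤ excess p t * R := by
    refine Finset.sum_sq_le_sum_mul_sum_of_sq_le_mul _ (fun i _ => ?_) (fun i _ => ?_)
      fun i _ => ?_
    · exact mul_nonneg (sub_nonneg.2 (cosT_le_one _)) (by linarith [neg_one_le_cosT (t i)])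
    · exact mul_nonneg (by linarith [neg_one_le_cosT (p i)]) (sub_nonneg.2 (cosT_le_one _))
    -- Since $\sin^2=(1-\cos)(1+\cos)$, each squared term of $F$ is exactly the product of the
    -- corresponding terms of $E$ and $R$.
    · rw [mul_pow, sinT_sq, sinT_sq]; exact le_of_eq (by ring)
  have h₁ : uEx p t = R + 2 * disp p - F := by
    simp only [hF, hR, uEx, disp, cosT_sub, Fin.sum_univ_three]; ring
  have h₂ : uEx p (-t) = R + 2 * disp p + F := by
    simp only [hF, hR, uEx, disp, cosT_sub, Fin.sum_univ_three, Pi.neg_apply, cosT_neg, sinT_neg]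
    ring
  have h₃ : uEx 0 t = R + 2 * disp p - excess p t := by
    rw [uEx_zero_left]
    simp only [hR, excess, disp, Fin.sum_univ_three]; ring
  rw [h₁, h₂, h₃]
  linarith [hCS]

lemma isAnalytic_excess (p : T3) : IsAnalytic (excess p) :=
  IsAnalytic.sum fun i => (isAnalytic_const _).mul ((isAnalytic_const 1).add (isAnalytic_cosT i))

lemma excess_ne_zero {p : T3} (hp : p ≠ 0) : excess p ≠ 0 := fun h => by
  have h0 : excess p 0 = 2 * disp p := by
    simp only [excess, disp, Pi.zero_apply, cosT_zero, Finset.mul_sum]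
    exact Finset.sum_congr rfl fun i _ => by ring
  have := disp_pos hp
  have h1 := congr_fun h 0
  rw [h0] at h1
  simp at h1
  linarith

lemma integral_sq_div_uEx_lt {φ : T3 → ℝ} (hφ : IsAnalytic φ) (hφ0 : φ ≠ 0)
    (hev : ∀ t, φ (-t) ^ 2 = φ t ^ 2) {p : T3} (hp : p ≠ 0) :
    ∫ t, φ t ^ 2 / uEx p t < ∫ t, φ t ^ 2 / uEx 0 t := by
  have hi := integrable_sq_div_uEx hφ.continuous
  have hin : Integrable fun t => φ t ^ 2 / uEx p (-t) := by
    simpa only [hev] using (hi p).comp_neg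
  have hn : ∫ t, φ t ^ 2 / uEx p (-t) = ∫ t, φ t ^ 2 / uEx p t := by
    rw [← integral_neg_eq_self]; simp only [hev, neg_neg]
  have hG : ∀ t, t ≠ 0 →
      2 * (φ t ^ 2 / uEx 0 t) - (φ t ^ 2 / uEx p t + φ t ^ 2 / uEx p (-t)) =
        φ t ^ 2 * (2 * (uEx p t * uEx p (-t)) - (uEx p t + uEx p (-t)) * uEx 0 t) /
          (uEx 0 t * uEx p t * uEx p (-t)) := by
    intro t ht
    have h₁ := (uEx_pos_of_right p ht).ne'
    have h₂ := (uEx_pos_of_right p (neg_ne_zero.2 ht)).ne'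
    have h₃ := (uEx_pos_of_right 0 ht).ne'
    field_simp
    ring
  have hpos : 0 < ∫ t, (2 * (φ t ^ 2 / uEx 0 t) - (φ t ^ 2 / uEx p t + φ t ^ 2 / uEx p (-t))) := by
    refine integral_pos_of_ne_zero (((hi 0).const_mul 2).sub ((hi p).add hin)) ?_
      -- The factor `disp` serves only to exclude $t=0$, where `hG` is unavailable.
      ((hφ.mul (isAnalytic_excess p)).mul isAnalytic_disp).continuous
      ((hφ.mul (isAnalytic_excess p)).mul_ne_zero isAnalytic_disp
        (hφ.mul_ne_zero (isAnalytic_excess p) hφ0 (excess_ne_zero hp)) disp_ne_zero)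
      fun t h => ?_
    · filter_upwards [ae_ne_zero] with t ht
      rw [hG t ht]
      have := four_mul_disp_mul_excess_le p t
      have := mul_nonneg (disp_nonneg p) (excess_nonneg p t)
      exact div_nonneg (mul_nonneg (sq_nonneg _) (by linarith))
        (mul_nonneg (mul_nonneg (uEx_nonneg _ _) (uEx_nonneg _ _)) (uEx_nonneg _ _))
    · obtain ⟨h', hd⟩ := mul_ne_zero_iff.1 h
      obtain ⟨hφt, he⟩ := mul_ne_zero_iff.1 h'
      have ht : t ≠ 0 := fun h0 => hd ((disp_eq_zero_iff t).2 h0)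
      rw [hG t ht]
      have h₁ := uEx_pos_of_right p ht
      have h₂ := uEx_pos_of_right p (neg_ne_zero.2 ht)
      have h₃ := uEx_pos_of_right 0 ht
      have := four_mul_disp_mul_excess_le p t
      have := mul_pos (disp_pos hp) ((excess_nonneg p t).lt_of_ne' he)
      have h₄ : 0 < 2 * (uEx p t * uEx p (-t)) - (uEx p t + uEx p (-t)) * uEx 0 t := by linarith
      positivity
  have hadd := integral_add (hi p) hin
  have hsub := integral_sub ((hi 0).const_mul 2) ((hi p).add hin)
  simp only [Pi.add_apply] at hsub
  rw [hsub, integral_const_mul, hadd, hn] at hpos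
  linarith

/-! ### Twofold differentiation under the integral sign. -/

/-- The partial derivative `∂u(p, t)/∂pᵢ`. -/
def uExDeriv (i : Fin 3) (p t : T3) : ℝ := sinT (p i) + sinT (p i - t i)

/-- The partial derivative `∂²u(p, t)/∂pᵢ∂pᵢ`. -/
def uExDeriv2 (i : Fin 3) (p t : T3) : ℝ := cosT (p i) + cosT (p i - t i)

lemma hasFDerivAt_uEx (t : T3) (x : Fin 3 → ℝ) :
    HasFDerivAt (fun x => uEx (proj x) t) (∑ i, uExDeriv i (proj x) t • coord i) x := by
  obtain ⟨y, rfl⟩ := surjective_proj t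
  simp only [uEx, uExDeriv, proj, ← AddCircle.coe_sub, cosT_coe, sinT_coe]
  refine HasFDerivAt.fun_sum fun i _ => ?_
  have h := (((coord i).hasFDerivAt (x := x)).cos.const_sub 3).sub_const (Real.cos (y i))
    |>.sub (((coord i).hasFDerivAt (x := x)).sub_const (y i)).cos
  refine h.congr_fderiv ?_
  simp only [ContinuousLinearMap.proj_apply]
  module

lemma hasFDerivAt_uExDeriv (i : Fin 3) (t : T3) (x : Fin 3 → ℝ) :
    HasFDerivAt (fun x => uExDeriv i (proj x) t) (uExDeriv2 i (proj x) t • coord i) x := by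
  obtain ⟨y, rfl⟩ := surjective_proj t
  simp only [uExDeriv, uExDeriv2, proj, ← AddCircle.coe_sub, cosT_coe, sinT_coe]
  have h := ((coord i).hasFDerivAt (x := x)).sin.add
    (((coord i).hasFDerivAt (x := x)).sub_const (y i)).sin
  refine h.congr_fderiv ?_
  simp only [ContinuousLinearMap.proj_apply]
  module

lemma continuous_uExDeriv (i : Fin 3) : Continuous fun z : T3 × T3 => uExDeriv i z.1 z.2 := by
  have := continuous_sinT
  unfold uExDeriv; fun_prop

lemma continuous_uExDeriv2 (i : Fin 3) : Continuous fun z : T3 × T3 => uExDeriv2 i z.1 z.2 := by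
  have := continuous_cosT
  unfold uExDeriv2; fun_prop

lemma abs_uExDeriv2_le (i : Fin 3) (p t : T3) : |uExDeriv2 i p t| ≤ 2 := by
  rw [uExDeriv2, abs_le]
  constructor <;> linarith [cosT_le_one (p i), cosT_le_one (p i - t i), neg_one_le_cosT (p i),
    neg_one_le_cosT (p i - t i)]

/-- The gradient is controlled by $\sqrt u$, as for any function near a quadratic minimum. Hence
$\partial_iu\,\partial_ju/u$ stays bounded, and the second derivative of $\varphi^2/u$ is no more
singular than $\varphi^2/u^2$. -/
lemma uExDeriv_sq_le (i : Fin 3) (p t : T3) : uExDeriv i p t ^ 2 ≤ 4 * uEx p t := by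
  have h (x : AddCircle (2 * Real.pi)) : sinT x ^ 2 ≤ 2 * (1 - cosT x) := by
    rw [sinT_sq]
    nlinarith [cosT_le_one x]
  have hd (s : T3) : 1 - cosT (s i) ≤ disp s :=
    Finset.single_le_sum (f := fun i => 1 - cosT (s i))
      (fun _ _ => sub_nonneg.2 (cosT_le_one _)) (Finset.mem_univ i)
  have h₁ := (h (p i)).trans (mul_le_mul_of_nonneg_left (hd p) two_pos.le)
  have h₂ := (h (p i - t i)).trans (mul_le_mul_of_nonneg_left (hd (p - t)) two_pos.le)
  rw [uEx_eq_disp, uExDeriv]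
  nlinarith [sq_nonneg (sinT (p i) - sinT (p i - t i)), disp_nonneg t]

lemma abs_uExDeriv_mul_le (i j : Fin 3) (p t : T3) :
    |uExDeriv i p t * uExDeriv j p t| ≤ 4 * uEx p t := by
  rw [abs_le]
  constructor <;> nlinarith [uExDeriv_sq_le i p t, uExDeriv_sq_le j p t,
    sq_nonneg (uExDeriv i p t - uExDeriv j p t), sq_nonneg (uExDeriv i p t + uExDeriv j p t)]

lemma abs_uExDeriv_le (i : Fin 3) (p t : T3) : |uExDeriv i p t| ≤ 2 := by
  have h (x : AddCircle (2 * Real.pi)) : |sinT x| ≤ 1 := by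
    rw [← sq_le_one_iff_abs_le_one, sinT_sq]
    nlinarith [sq_nonneg (cosT x)]
  refine (abs_add_le _ _).trans ?_
  linarith [h (p i), h (p i - t i)]

lemma integrable_of_le_inv_disp {f : T3 → ℝ} {C : ℝ} (hf : Measurable f)
    (hC : ∀ t, t ≠ 0 → |f t| ≤ C * (disp t)⁻¹) : Integrable f := by
  refine (integrable_inv_disp.const_mul C).mono' hf.aestronglyMeasurable ?_
  filter_upwards [ae_ne_zero] with t ht using hC t ht

/-- Differentiation under the integral sign, for integrands dominated by a multiple of
`1 / disp`. -/
lemma hasFDerivAt_integral_of_le_inv_disp {h : (Fin 3 → ℝ) → T3 → ℝ}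
    {h' : Fin 3 → (Fin 3 → ℝ) → T3 → ℝ} {C C' : ℝ} (hm : ∀ x, Measurable (h x))
    (hm' : ∀ i x, Measurable (h' i x)) (hC : ∀ x t, t ≠ 0 → |h x t| ≤ C * (disp t)⁻¹)
    (hC' : ∀ i x t, t ≠ 0 → |h' i x t| ≤ C' * (disp t)⁻¹)
    (hd : ∀ t, t ≠ 0 → ∀ x, HasFDerivAt (h · t) (∑ i, h' i x t • coord i) x) (x : Fin 3 → ℝ) :
    HasFDerivAt (fun x => ∫ t, h x t) (∑ i, (∫ t, h' i x t) • coord i) x := by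
  have hI : ∫ t, ∑ i, h' i x t • coord i = ∑ i, (∫ t, h' i x t) • coord i := by
    rw [integral_finsetSum]
    · exact Finset.sum_congr rfl fun i _ => integral_smul_const (h' i x) (coord i)
    · exact fun i _ => (integrable_of_le_inv_disp (hm' i x) (hC' i x)).smul_const (coord i)
  rw [← hI]
  have hcoord (i : Fin 3) : ‖coord i‖ ≤ 1 :=
    ContinuousLinearMap.opNorm_le_bound _ zero_le_one fun y => by
      simpa using norm_le_pi_norm y i
  -- The bounds hold for every `x`, so the whole space serves as the neighbourhood.
  refine hasFDerivAt_integral_of_dominated_of_fderiv_le (𝕜 := ℝ) (s := Set.univ)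
    (F' := fun x t => ∑ i, h' i x t • coord i)
    (bound := fun t => ∑ _i : Fin 3, C' * (disp t)⁻¹)
    Filter.univ_mem (.of_forall fun x => (hm x).aestronglyMeasurable)
    (integrable_of_le_inv_disp (hm x) (hC x)) ?_ ?_
    (integrable_finsetSum _ fun _ _ => integrable_inv_disp.const_mul C') ?_
  · exact Finset.aestronglyMeasurable_fun_sum _
      fun i _ => ((hm' i x).aestronglyMeasurable).smul_const (coord i)
  · filter_upwards [ae_ne_zero] with t ht x _
    refine (norm_sum_le _ _).trans (Finset.sum_le_sum fun i _ => ?_)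
    rw [norm_smul (h' i x t) (coord i)]
    exact (mul_le_of_le_one_right (norm_nonneg (h' i x t)) (hcoord i)).trans (hC' i x t ht)
  · filter_upwards [ae_ne_zero] with t ht x _ using hd t ht x

/-- The derivative in `pᵢ` of the integrand `φ² / u(p, ·)`. -/
def integrandDeriv (φ : T3 → ℝ) (i : Fin 3) (p t : T3) : ℝ :=
  -(φ t ^ 2 / uEx p t ^ 2 * uExDeriv i p t)

/-- The second derivative in `pᵢ` and `pⱼ` of the integrand `φ² / u(p, ·)`. -/
def integrandDeriv2 (φ : T3 → ℝ) (i j : Fin 3) (p t : T3) : ℝ :=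
  φ t ^ 2 / uEx p t ^ 2 *
    (2 * (uExDeriv i p t * uExDeriv j p t) / uEx p t - if i = j then uExDeriv2 i p t else 0)

section

variable {φ : T3 → ℝ} {C : ℝ}

lemma measurable_integrandDeriv (hφ : Continuous φ) (i : Fin 3) (p : T3) :
    Measurable (integrandDeriv φ i p) := by
  have h₁ := (continuous_uEx_right p).measurable
  have h₂ : Measurable (uExDeriv i p) :=
    ((continuous_uExDeriv i).comp (by fun_prop : Continuous fun t : T3 => (p, t))).measurable
  exact (((hφ.pow 2).measurable.div (h₁.pow_const 2)).mul h₂).neg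

lemma measurable_integrandDeriv2 (hφ : Continuous φ) (i j : Fin 3) (p : T3) :
    Measurable (integrandDeriv2 φ i j p) := by
  have h₁ := (continuous_uEx_right p).measurable
  have h₂ (i : Fin 3) : Measurable (uExDeriv i p) :=
    ((continuous_uExDeriv i).comp (by fun_prop : Continuous fun t : T3 => (p, t))).measurable
  have h₃ : Measurable fun t => if i = j then uExDeriv2 i p t else 0 := by
    split_ifs
    · exact ((continuous_uExDeriv2 i).comp
        (by fun_prop : Continuous fun t : T3 => (p, t))).measurable
    · exact measurable_const
  exact ((hφ.pow 2).measurable.div (h₁.pow_const 2)).mul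
    (((((h₂ i).mul (h₂ j)).const_mul 2).div h₁).sub h₃)

lemma continuous_integrandDeriv2 (i j : Fin 3) {t : T3} (ht : t ≠ 0) :
    Continuous fun p => integrandDeriv2 φ i j p t := by
  have h₁ := continuous_uEx_left t
  have h₀ (p : T3) := (uEx_pos_of_right p ht).ne'
  have h₂ (i : Fin 3) : Continuous fun p => uExDeriv i p t :=
    (continuous_uExDeriv i).comp (by fun_prop : Continuous fun p : T3 => (p, t))
  have h₃ : Continuous fun p => if i = j then uExDeriv2 i p t else 0 := by
    split_ifs
    · exact (continuous_uExDeriv2 i).comp (by fun_prop : Continuous fun p : T3 => (p, t))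
    · exact continuous_const
  exact (continuous_const.div (h₁.pow 2) fun p => pow_ne_zero 2 (h₀ p)).mul
    (((((h₂ i).mul (h₂ j)).const_mul 2).div h₁ h₀).sub h₃)

/-- The hypothesis on `φ` cancels one of the two powers of `disp`; this is where vanishing of `φ` at
the origin enters. -/
lemma sq_div_uEx_sq_le (hC : ∀ t, φ t ^ 2 ≤ C * disp t) (p : T3) {t : T3} (ht : t ≠ 0) :
    φ t ^ 2 / uEx p t ^ 2 ≤ C * (disp t)⁻¹ := by
  have hd := disp_pos ht
  calc φ t ^ 2 / uEx p t ^ 2 ≤ C * disp t / disp t ^ 2 :=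
        div_le_div₀ ((sq_nonneg _).trans (hC t)) (hC t) (by positivity)
          (pow_le_pow_left₀ hd.le (disp_le_uEx p t) 2)
    _ = C * (disp t)⁻¹ := by field_simp

lemma abs_integrandDeriv_le (hC : ∀ t, φ t ^ 2 ≤ C * disp t) (i : Fin 3) (p : T3) {t : T3}
    (ht : t ≠ 0) : |integrandDeriv φ i p t| ≤ 2 * C * (disp t)⁻¹ := by
  rw [integrandDeriv, abs_neg, abs_mul, abs_of_nonneg (by positivity)]
  calc φ t ^ 2 / uEx p t ^ 2 * |uExDeriv i p t| ≤ φ t ^ 2 / uEx p t ^ 2 * 2 :=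
        mul_le_mul_of_nonneg_left (abs_uExDeriv_le i p t) (by positivity)
    _ ≤ 2 * C * (disp t)⁻¹ := by linarith [sq_div_uEx_sq_le hC p ht]

lemma abs_integrandDeriv2_le (hC : ∀ t, φ t ^ 2 ≤ C * disp t) (i j : Fin 3) (p : T3) {t : T3}
    (ht : t ≠ 0) : |integrandDeriv2 φ i j p t| ≤ 10 * C * (disp t)⁻¹ := by
  have hu := uEx_pos_of_right p ht
  have h₁ : |2 * (uExDeriv i p t * uExDeriv j p t) / uEx p t| ≤ 8 := by
    rw [abs_div, abs_of_pos hu, div_le_iff₀ hu, abs_mul, abs_two]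
    linarith [abs_uExDeriv_mul_le i j p t]
  have h₂ : |if i = j then uExDeriv2 i p t else 0| ≤ 2 := by
    split_ifs
    · exact abs_uExDeriv2_le i p t
    · simp
  rw [integrandDeriv2, abs_mul, abs_of_nonneg (by positivity)]
  calc _ ≤ φ t ^ 2 / uEx p t ^ 2 * 10 :=
        mul_le_mul_of_nonneg_left ((abs_sub _ _).trans (by linarith)) (by positivity)
    _ ≤ 10 * C * (disp t)⁻¹ := by linarith [sq_div_uEx_sq_le hC p ht]

lemma hasFDerivAt_integrand {t : T3} (ht : t ≠ 0) (x : Fin 3 → ℝ) :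
    HasFDerivAt (fun x => φ t ^ 2 / uEx (proj x) t)
      (∑ i, integrandDeriv φ i (proj x) t • coord i) x := by
  have hu := (uEx_pos_of_right (proj x) ht).ne'
  have h := ((hasDerivAt_inv hu).comp_hasFDerivAt x (hasFDerivAt_uEx t x)).const_mul (φ t ^ 2)
  refine h.congr_fderiv ?_
  simp only [Finset.smul_sum, smul_smul]
  refine Finset.sum_congr rfl fun i _ => ?_
  congr 1
  rw [integrandDeriv]
  ring

lemma hasFDerivAt_integrandDeriv (i : Fin 3) {t : T3} (ht : t ≠ 0) (x : Fin 3 → ℝ) :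
    HasFDerivAt (fun x => integrandDeriv φ i (proj x) t)
      (∑ j, integrandDeriv2 φ i j (proj x) t • coord j) x := by
  have hu := (uEx_pos_of_right (proj x) ht).ne'
  have h₁ := (((hasDerivAt_inv (pow_ne_zero 2 hu)).comp_hasFDerivAt x
    ((hasFDerivAt_uEx t x).pow 2)).const_mul (φ t ^ 2))
  have h := (h₁.mul (hasFDerivAt_uExDeriv i t x)).neg
  refine h.congr_fderiv ?_
  -- The mixed second derivatives of $u$ in $p$ vanish; the Kronecker delta puts both contributions
  -- into one sum over `j`.
  have hδ : uExDeriv2 i (proj x) t • coord i =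
      ∑ j, (if i = j then uExDeriv2 i (proj x) t else 0) • coord j := by
    simp
  rw [hδ]
  simp only [Finset.smul_sum, smul_smul, ← Finset.sum_add_distrib, ← Finset.sum_neg_distrib,
    ← add_smul, ← neg_smul]
  refine Finset.sum_congr rfl fun j _ => ?_
  congr 1
  rw [integrandDeriv2]
  simp only [Function.comp]
  field_simp
  ring

lemma hasFDerivAt_lam (hφ : Continuous φ) (hC : ∀ t, φ t ^ 2 ≤ C * disp t) (x : Fin 3 → ℝ) :
    HasFDerivAt (fun x => ∫ t, φ t ^ 2 / uEx (proj x) t)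
      (∑ i, (∫ t, integrandDeriv φ i (proj x) t) • coord i) x := by
  obtain ⟨M, hM⟩ := exists_sq_le hφ
  exact hasFDerivAt_integral_of_le_inv_disp
    (h' := fun i x t => integrandDeriv φ i (proj x) t)
    (fun x => measurable_sq_div_uEx hφ (proj x))
    (fun i x => measurable_integrandDeriv hφ i (proj x))
    (fun x _ ht => sq_div_uEx_le hM (proj x) ht)
    (fun i x _ ht => abs_integrandDeriv_le hC i (proj x) ht)
    (fun _ ht x => hasFDerivAt_integrand ht x) x

lemma hasFDerivAt_integral_integrandDeriv (hφ : Continuous φ) (hC : ∀ t, φ t ^ 2 ≤ C * disp t)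
    (i : Fin 3) (x : Fin 3 → ℝ) :
    HasFDerivAt (fun x => ∫ t, integrandDeriv φ i (proj x) t)
      (∑ j, (∫ t, integrandDeriv2 φ i j (proj x) t) • coord j) x :=
  hasFDerivAt_integral_of_le_inv_disp
    (h' := fun j x t => integrandDeriv2 φ i j (proj x) t)
    (fun x => measurable_integrandDeriv hφ i (proj x))
    (fun j x => measurable_integrandDeriv2 hφ i j (proj x))
    (fun x _ ht => abs_integrandDeriv_le hC i (proj x) ht)
    (fun j x _ ht => abs_integrandDeriv2_le hC i j (proj x) ht)
    (fun _ ht x => hasFDerivAt_integrandDeriv i ht x) x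

lemma continuous_integral_integrandDeriv2 (hφ : Continuous φ) (hC : ∀ t, φ t ^ 2 ≤ C * disp t)
    (i j : Fin 3) : Continuous fun p => ∫ t, integrandDeriv2 φ i j p t := by
  refine continuous_of_dominated
    (fun p => (measurable_integrandDeriv2 hφ i j p).aestronglyMeasurable)
    (fun p => ?_) (integrable_inv_disp.const_mul (10 * C)) ?_
  · filter_upwards [ae_ne_zero] with t ht using abs_integrandDeriv2_le hC i j p ht
  · filter_upwards [ae_ne_zero] with t ht using continuous_integrandDeriv2 i j ht

lemma contDiff_lam (hφ : Continuous φ) (hC : ∀ t, φ t ^ 2 ≤ C * disp t) :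
    ContDiff ℝ 2 (fun x => ∫ t, φ t ^ 2 / uEx (proj x) t) := by
  rw [← one_add_one_eq_two]
  refine contDiff_succ_iff_hasFDerivAt.2 ⟨_, ?_, hasFDerivAt_lam hφ hC⟩
  refine ContDiff.sum fun i _ => ContDiff.fun_smul ?_ contDiff_const
  refine contDiff_one_iff_hasFDerivAt.2 ⟨_, ?_, hasFDerivAt_integral_integrandDeriv hφ hC i⟩
  exact continuous_finsetSum _ fun j _ =>
    ((continuous_integral_integrandDeriv2 hφ hC i j).comp continuous_proj).smul continuous_const

lemma hessian_lam (hφ : Continuous φ) (hC : ∀ t, φ t ^ 2 ≤ C * disp t) (α : Fin 2)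
    (i j : Fin 3) : hessian (Lam uEx α φ) i j = ∫ t, integrandDeriv2 φ j i 0 t := by
  have hL : lift (Lam uEx α φ) = fun x => ∫ t, φ t ^ 2 / uEx (proj x) t :=
    funext fun x => lam_uEx α φ (proj x)
  have hdir (L : Fin 3 → ℝ) (k : Fin 3) : (∑ i, L i • coord i) (dir k) = L k := by
    simp [dir, sum_apply, Pi.single_apply]
  have hG : HasFDerivAt
      (fun y => (∑ i, (∫ t, integrandDeriv φ i (proj y) t) • coord i) (dir j))
      (∑ k, (∫ t, integrandDeriv2 φ j k (proj 0) t) • coord k) 0 := by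
    simp only [hdir]
    exact hasFDerivAt_integral_integrandDeriv hφ hC j 0
  have hp : proj 0 = 0 := rfl
  rw [hessian, Matrix.of_apply, hL, partial2_eq (hasFDerivAt_lam hφ hC) hG, hdir, hp]

/-! ### Negative definiteness of the Hessian of $\Lambda_\alpha$. -/

/-- The defect in the Cauchy--Schwarz inequality
`(∑ ξᵢ sin tᵢ)² ≤ (∑ (1 - cos tᵢ)) (∑ ξᵢ² (1 + cos tᵢ))`. -/
def defect (ξ : Fin 3 → ℝ) (t : T3) : ℝ :=
  disp t * ∑ i, ξ i * ξ i * (1 + cosT (t i)) -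
    (∑ i, ξ i * sinT (t i)) * ∑ i, ξ i * sinT (t i)

lemma defect_nonneg (ξ : Fin 3 → ℝ) (t : T3) : 0 ≤ defect ξ t := by
  rw [defect, ← sq, sub_nonneg]
  refine Finset.sum_sq_le_sum_mul_sum_of_sq_le_mul _
    (fun i _ => sub_nonneg.2 (cosT_le_one _))
    (fun i _ => mul_nonneg (mul_self_nonneg _) (by linarith [neg_one_le_cosT (t i)]))
    fun i _ => ?_
  rw [mul_pow, sinT_sq]
  exact le_of_eq (by ring)

lemma isAnalytic_defect (ξ : Fin 3 → ℝ) : IsAnalytic (defect ξ) := by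
  have h : IsAnalytic fun t => ∑ i, ξ i * sinT (t i) :=
    IsAnalytic.sum fun i => (isAnalytic_const _).mul (isAnalytic_sinT i)
  exact (isAnalytic_disp.mul (IsAnalytic.sum fun i => (isAnalytic_const _).mul
    ((isAnalytic_const 1).add (isAnalytic_cosT i)))).sub (h.mul h)

lemma defect_ne_zero {ξ : Fin 3 → ℝ} (hξ : ξ ≠ 0) : defect ξ ≠ 0 := fun h => by
  obtain ⟨i, hi⟩ := Function.ne_iff.1 hξ
  -- At this point all sines vanish and only the `i`-th coordinate has $1+\cos\ne0$, so the defect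
  -- is $4\cdot2\xi_i^2$.
  have h₁ := congr_fun h fun k => if k = i then 0 else ((Real.pi : ℝ) : AddCircle (2 * Real.pi))
  have hi' : ξ i ≠ 0 := hi
  fin_cases i <;> simp [defect, disp, Fin.sum_univ_three] at h₁ hi' <;>
    first | exact hi' h₁ | (norm_num at h₁; exact hi' h₁)

lemma posDef_neg_hessian_lam (hφ : IsAnalytic φ) (hφ0 : φ ≠ 0)
    (hC : ∀ t, φ t ^ 2 ≤ C * disp t) (α : Fin 2) : (-hessian (Lam uEx α φ)).PosDef := by
  have hH := hessian_lam hφ.continuous hC α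
  have hint (i j : Fin 3) : Integrable (integrandDeriv2 φ i j 0) :=
    integrable_of_le_inv_disp (measurable_integrandDeriv2 hφ.continuous i j 0)
      fun t ht => abs_integrandDeriv2_le hC i j 0 ht
  refine Matrix.PosDef.of_dotProduct_mulVec_pos ?_ fun ξ hξ => ?_
  · ext i j
    simp only [Matrix.conjTranspose_apply, Matrix.neg_apply, hH, star_trivial]
    congr 2
    funext t
    by_cases hij : i = j
    · rw [hij]
    · simp only [integrandDeriv2, hij, Ne.symm hij, if_false, mul_comm (uExDeriv i 0 t)]
  · have hneg (i j : Fin 3) : Integrable fun t => -(ξ i * ξ j * integrandDeriv2 φ j i 0 t) :=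
      ((hint j i).const_mul (ξ i * ξ j)).neg
    have hq : star ξ ⬝ᵥ (-hessian (Lam uEx α φ)).mulVec ξ =
        ∫ t, ∑ i, ∑ j, -(ξ i * ξ j * integrandDeriv2 φ j i 0 t) := by
      rw [integral_finsetSum _ fun i _ => integrable_finsetSum _ fun j _ => hneg i j]
      simp only [dotProduct, Matrix.mulVec, star_trivial, Finset.mul_sum]
      refine Finset.sum_congr rfl fun i _ => ?_
      rw [integral_finsetSum _ fun j _ => hneg i j]
      refine Finset.sum_congr rfl fun j _ => ?_
      rw [integral_neg, integral_const_mul, Matrix.neg_apply, hH]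
      ring
    -- At $p=0$ one has $\partial_iu=-\sin t_i$, $\partial_i^2u=1+\cos t_i$ and $u=2\varepsilon(t)$,
    -- which turns the quadratic form into the defect.
    have hF : ∀ t, t ≠ 0 → ∑ i, ∑ j, -(ξ i * ξ j * integrandDeriv2 φ j i 0 t) =
        φ t ^ 2 / uEx 0 t ^ 2 * (defect ξ t / disp t) := by
      intro t ht
      have hd := (disp_pos ht).ne'
      simp only [integrandDeriv2, uExDeriv, uExDeriv2, defect, Pi.zero_apply, sinT_zero, cosT_zero,
        zero_sub, sinT_neg, cosT_neg, zero_add, uEx_zero_left, Fin.sum_univ_three]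
      simp
      field_simp
      ring
    rw [hq]
    refine integral_pos_of_ne_zero
      (integrable_finsetSum _ fun i _ => integrable_finsetSum _ fun j _ => hneg i j) ?_
      ((hφ.mul (isAnalytic_defect ξ)).mul isAnalytic_disp).continuous
      ((hφ.mul (isAnalytic_defect ξ)).mul_ne_zero isAnalytic_disp
        (hφ.mul_ne_zero (isAnalytic_defect ξ) hφ0 (defect_ne_zero hξ)) disp_ne_zero)
      fun t h => ?_
    · filter_upwards [ae_ne_zero] with t ht
      rw [hF t ht]
      exact mul_nonneg (by positivity) (div_nonneg (defect_nonneg ξ t) (disp_nonneg t))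
    · obtain ⟨h', hd⟩ := mul_ne_zero_iff.1 h
      obtain ⟨hφt, he⟩ := mul_ne_zero_iff.1 h'
      have ht : t ≠ 0 := fun h0 => hd ((disp_eq_zero_iff t).2 h0)
      rw [hF t ht]
      exact mul_ne_zero (div_ne_zero (pow_ne_zero 2 hφt)
        (pow_ne_zero 2 (uEx_pos_of_right 0 ht).ne')) (div_ne_zero he hd)

/-! ### Assembly, and the quadratic bound for the two forms of $\varphi_\alpha$. -/

lemma hypLam_uEx (hφ : IsAnalytic φ) (hφ0 : φ ≠ 0) (hev : ∀ t, φ (-t) ^ 2 = φ t ^ 2)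
    (hC : φ 0 = 0 → ∃ C, ∀ t, φ t ^ 2 ≤ C * disp t) (α : Fin 2) : HypLam uEx α φ := by
  have hlt : ∀ p, p ≠ 0 → Lam uEx α φ p < Lam uEx α φ 0 := fun p hp => by
    rw [lam_uEx, lam_uEx]
    exact integral_sq_div_uEx_lt hφ hφ0 hev hp
  refine ⟨fun p => ?_, ?_, hlt, fun h0 => ?_⟩
  · unfold integrand
    simpa only [fiber_uEx] using integrable_sq_div_uEx hφ.continuous p
  · rw [funext (lam_uEx α φ)]
    exact continuous_integral_sq_div_uEx hφ.continuous
  · obtain ⟨C, hC⟩ := hC h0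
    refine ⟨?_, .of_forall fun p => ?_, posDef_neg_hessian_lam hφ hφ0 hC α⟩
    · have hL : lift (Lam uEx α φ) = fun x => ∫ t, φ t ^ 2 / uEx (proj x) t :=
        funext fun x => lam_uEx α φ (proj x)
      rw [hL]
      exact (contDiff_lam hφ.continuous hC).contDiffAt
    · by_cases hp : p = 0
      · rw [hp]
      · exact (hlt p hp).le

end

end TorusModel

end

theorem lemmaB1 (φ : Fin 2 → TorusModel.T3 → ℝ)
    (hform : ∀ α,
      (∃ (a₀ : ℝ) (a : Fin 3 → ℝ), ∀ p, φ α p = a₀ + ∑ i, a i * TorusModel.cosT (p i)) ∨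
      (∃ a : ℝ, ∀ p, φ α p = a * ∑ i, TorusModel.sinT (p i)))
    (hne : ∀ α, φ α ≠ 0) :
    TorusModel.HypU TorusModel.uEx ∧
    (∀ α, TorusModel.HypPhi (φ α)) ∧
    (∀ α, TorusModel.HypLam TorusModel.uEx α (φ α)) := by
  open TorusModel in
  have hpar : ∀ α, Function.Even (φ α) ∨ Function.Odd (φ α) := fun α => by
    rcases hform α with ⟨a₀, a, h⟩ | ⟨a, h⟩
    · exact Or.inl fun p => by simp only [h, Pi.neg_apply, cosT_neg]
    · exact Or.inr fun p => by
        simp only [h, Pi.neg_apply, sinT_neg, Finset.sum_neg_distrib, mul_neg]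
  have han : ∀ α, IsAnalytic (φ α) := fun α => by
    rcases hform α with ⟨a₀, a, h⟩ | ⟨a, h⟩
    · rw [funext h]
      exact (isAnalytic_const a₀).add
        (IsAnalytic.sum fun i => (isAnalytic_const (a i)).mul (isAnalytic_cosT i))
    · rw [funext h]
      exact (isAnalytic_const a).mul (IsAnalytic.sum fun i => isAnalytic_sinT i)
  have hC : ∀ α, φ α 0 = 0 → ∃ C, ∀ t, φ α t ^ 2 ≤ C * disp t := fun α h0 => by
    rcases hform α with ⟨a₀, a, h⟩ | ⟨a, h⟩
    · refine ⟨2 * ∑ i, a i ^ 2, fun t => ?_⟩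
      rw [h] at h0
      -- Vanishing at the origin fixes $a_0=-\sum_ia_i$, so `φ` is a combination of the $1-\cos
      -- t_i$.
      have ht : φ α t = ∑ i, -(a i * (1 - cosT (t i))) := by
        rw [h, eq_neg_of_add_eq_zero_left h0]
        simp only [Pi.zero_apply, cosT_zero, Fin.sum_univ_three]
        ring
      rw [ht, mul_assoc, mul_left_comm, disp, Finset.mul_sum]
      refine Finset.sum_sq_le_sum_mul_sum_of_sq_le_mul _ (fun _ _ => sq_nonneg _)
        (fun i _ => mul_nonneg two_pos.le (sub_nonneg.2 (cosT_le_one _))) fun i _ => ?_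
      rw [neg_sq, mul_pow]
      refine mul_le_mul_of_nonneg_left ?_ (sq_nonneg _)
      -- The constant $2$ comes from $(1-c)^2\le2(1-c)$ for $c\in[-1,1]$.
      nlinarith [cosT_le_one (t i), neg_one_le_cosT (t i)]
    · refine ⟨2 * ∑ _i : Fin 3, a ^ 2, fun t => ?_⟩
      rw [h, Finset.mul_sum, mul_assoc, mul_left_comm, disp, Finset.mul_sum Finset.univ _ 2]
      refine Finset.sum_sq_le_sum_mul_sum_of_sq_le_mul _ (fun _ _ => sq_nonneg _)
        (fun i _ => mul_nonneg two_pos.le (sub_nonneg.2 (cosT_le_one _))) fun i _ => ?_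
      rw [mul_pow, sinT_sq]
      refine mul_le_mul_of_nonneg_left ?_ (sq_nonneg _)
      nlinarith [cosT_le_one (t i), neg_one_le_cosT (t i)]
  refine ⟨hypU_uEx, fun α => ⟨han α, hpar α⟩, fun α => ?_⟩
  refine hypLam_uEx (han α) (hne α) (fun t => ?_) (hC α) α
  rcases hpar α with h | h
  · rw [h t]
  · rw [h t, neg_sq]
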